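/- A mixed graph is a triple $G=(V,\mathcal D,\mathcal B)$ with $V$ finite, $\mathcal D\subseteq V\times V$ a set of directed edges $i\to j$, and $\mathcal B$ a set of unordered pairs of vertices, the bidirected edges $i\leftrightarrow j$. Write $\mathrm{pa}(i)=\{j: j\to i\in\mathcal D\}$ and $\mathrm{sib}(i)=\{j: j\leftrightarrow i\in\mathcal B\}$. A sink is a vertex that is not a parent of any other vertex. A subgraph of $G$ is a mixed graph $(V',\mathcal D',\mathcal B')$ with $V'\subseteq V$, $\mathcal D'\subseteq\mathcal D$, $\mathcal B'\subseteq\mathcal B$. The graph $G$ is *globally identifiable* if $(V,\mathcal D)$ has no directed cycles and no subgraph $(V',\mathcal D',\mathcal B')$ of $G$ with $|V'|\ge 2$ has both a connected bidirected part $(V',\mathcal B')$ and a unique sink in its directed part $(V',\mathcal D')$. A vertex $j$ is *ancestral* if it lies on no directed cycle and no vertex $k\ne j$ has both $k\leftrightarrow j\in\mathcal B$ and a directed path from $k$ to $j$. Let $\mathit{PD}_V$ be the set of real symmetric positive definite $V\times V$ matrices, and let $$\mathcal M(G)=\{(I-\Lambda)^{-T}\,\Omega\,(I-\Lambda)^{-1}\},$$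 where $\Lambda$ ranges over the real $V\times V$ matrices with $I-\Lambda$ invertible and $\lambda_{ij}=0$ whenever $i\to j\notin\mathcal D$, and $\Omega$ ranges over the matrices in $\mathit{PD}_V$ with $\omega_{ij}=0$ whenever $i\ne j$ and $i\leftrightarrow j\notin\mathcal B$. Let $\Sigma=(\sigma_{ij})$ be a symmetric $V\times V$ matrix of indeterminates. For $i\in V$ and $J\subseteq V$, let $F_{i,J}$ be the matrix of polynomials $$F_{i,J}=\Big(\big|\Sigma_{\mathrm{pa}(r)\uplus\{r\},\,\mathrm{pa}(r)\uplus\{c\}}\big|\Big)_{r\in\mathrm{pa}(i)\uplus J,\ c\in\mathrm{pa}(i)\uplus\{i\}},$$ where $\uplus$ is the sum of multisets and, in each inner determinant, the rows and the columns indexed by $\mathrm{pa}(r)$ come first, in the same order, followed by the row $r$ and the column $c$, respectively (so the determinant is $0$ if $c\in\mathrm{pa}(r)$). The *parentally nested determinants* for the pair $(i,J)$ are the minors of order $|\mathrm{pa}(i)|+1$ of $F_{i,J}$. **Theorem.** Let $G=(V,\mathcal D,\mathcal B)$ be a globally identifiable mixed graph with vertex set $V=[p]=\{1,\dots,p\}$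 enumerated in a topological order, that is, $i<j$ for every $i\to j\in\mathcal D$. Suppose that all vertices in $[p-1]$ are ancestral. Let $\mathcal F(G)$ be the set of all parentally nested determinants for the pairs $(i,\,[i-1]\setminus(\mathrm{pa}(i)\cup\mathrm{sib}(i)))$, $i\in V$, and let $\mathcal V_{\mathcal F(G)}$ be the set of real symmetric $V\times V$ matrices at which all polynomials in $\mathcal F(G)$ vanish. Then $$\mathcal M(G)=\mathit{PD}_V\cap\mathcal V_{\mathcal F(G)}.$$ -/

import Mathlib

open scoped Matrix

/-- A mixed graph `(V, D, B)`: directed edges are ordered pairs of vertices, `(i, j)` standing for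
`i → j`; bidirected edges are unordered pairs of vertices, `s(i, j)` standing for `i ↔ j`. -/
structure MixedGraph (V : Type*) where
  dir : Set (V × V)
  bidir : Set (Sym2 V)

namespace MixedGraph

section Combinatorics

variable {V : Type*} (G : MixedGraph V)

/-- There is a directed path (with at least one edge) from `i` to `j`. -/
def HasDirectedPath (i j : V) : Prop :=
  Relation.TransGen (fun a b => (a, b) ∈ G.dir) i j

/-- The graph has no directed cycles. -/
def Acyclic : Prop := ∀ v, ¬ G.HasDirectedPath v v

/-- A vertex `j` is ancestral if it is not on any directed cycle and no vertex `k ≠ j` has both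
`k ↔ j` and a directed path from `k` to `j`. -/
def IsAncestral (j : V) : Prop :=
  ¬ G.HasDirectedPath j j ∧
    ∀ k, k ≠ j → ¬ (s(k, j) ∈ G.bidir ∧ G.HasDirectedPath k j)

/-- A sink is a vertex that is not a parent of any other vertex. -/
def IsSink (v : V) : Prop := ∀ w, w ≠ v → (v, w) ∉ G.dir

/-- The bidirected part `(V, B)` is connected (and `V` is nonempty). -/
def BidirConnected : Prop := (SimpleGraph.fromEdgeSet G.bidir).Connected

/-- The mixed graph `H` on the vertex set `W ⊆ V` is a (not necessarily induced) subgraph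
of `G`. -/
def IsSubgraph {W : Set V} (H : MixedGraph W) : Prop :=
  (∀ e ∈ H.dir, ((e.1 : V), (e.2 : V)) ∈ G.dir) ∧
    ∀ e ∈ H.bidir, Sym2.map ((↑) : W → V) e ∈ G.bidir

/-- `G` is globally identifiable if it is acyclic and no subgraph with at least two vertices has
both a connected bidirected part and a unique sink in its directed part. -/
def GloballyIdentifiable : Prop :=
  G.Acyclic ∧
    ∀ (W : Set V) (H : MixedGraph W), W.Nontrivial → G.IsSubgraph H →
      ¬ (H.BidirConnected ∧ ∃! v, H.IsSink v)

end Combinatorics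

noncomputable section Models

variable {V : Type*} [Fintype V] [DecidableEq V] (G : MixedGraph V)

open Classical in
/-- The parents of `i`. -/
def pa (i : V) : Finset V := Finset.univ.filter fun j => (j, i) ∈ G.dir

open Classical in
/-- The siblings of `i`. -/
def sib (i : V) : Finset V := Finset.univ.filter fun j => s(j, i) ∈ G.bidir

/-- The matrices `Λ` supported on the directed edges with `I - Λ` invertible. -/
def coeffReg : Set (Matrix V V ℝ) :=
  {L | (∀ i j, (i, j) ∉ G.dir → L i j = 0) ∧ IsUnit (1 - L)}

/-- The positive definite matrices supported on the diagonal and the bidirected edges. -/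
def errorPD : Set (Matrix V V ℝ) :=
  {W | W.PosDef ∧ ∀ i j, i ≠ j → s(i, j) ∉ G.bidir → W i j = 0}

/-- The covariance matrices `(I - Λ)⁻ᵀ Ω (I - Λ)⁻¹` of the linear structural equation model
of `G`. -/
def model : Set (Matrix V V ℝ) :=
  {S | ∃ L ∈ G.coeffReg, ∃ W ∈ G.errorPD, S = ((1 - L)⁻¹)ᵀ * W * (1 - L)⁻¹}

/-- The symmetric matrix of indeterminates, one for each unordered pair of vertices. -/
def symbolicCov : Matrix V V (MvPolynomial (Sym2 V) ℝ) :=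
  Matrix.of fun i j => MvPolynomial.X s(i, j)

/-- The polynomial `|Σ_{pa(r) ⊎ {r}, pa(r) ⊎ {c}}|`. Rows and columns are listed with `pa(r)` first,
in the same order, followed by `r` for the rows and by `c` for the columns. If `c ∈ pa(r)`, a column
is repeated. -/
def parentDet (r c : V) : MvPolynomial (Sym2 V) ℝ :=
  ((symbolicCov (V := V)).submatrix
    (Sum.elim (fun a : {x // x ∈ G.pa r} => (a : V)) (fun _ : Unit => r))
    (Sum.elim (fun a : {x // x ∈ G.pa r} => (a : V)) (fun _ : Unit => c))).det

/-- The matrix `F_{i,J}`, with rows indexed by `pa(i) ⊎ J` and columns by `pa(i) ⊎ {i}`. -/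
def nestedMatrix (i : V) (J : Finset V) :
    Matrix ({x // x ∈ G.pa i} ⊕ {x // x ∈ J}) ({x // x ∈ G.pa i} ⊕ Unit)
      (MvPolynomial (Sym2 V) ℝ) :=
  Matrix.of fun r c =>
    G.parentDet (Sum.elim (fun a : {x // x ∈ G.pa i} => (a : V)) (fun a : {x // x ∈ J} => (a : V)) r)
      (Sum.elim (fun a : {x // x ∈ G.pa i} => (a : V)) (fun _ : Unit => i) c)

/-- The parentally nested determinants for `(i, J)`: the minors of order `|pa(i)| + 1` of `F_{i,J}`.
The embedding `e` selects the `|pa(i)| + 1` rows of the minor, in any order, so every minor occurs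
with either sign when it has at least two rows. -/
def parentallyNestedDets (i : V) (J : Finset V) : Set (MvPolynomial (Sym2 V) ℝ) :=
  {f | ∃ e : ({x // x ∈ G.pa i} ⊕ Unit) ↪ ({x // x ∈ G.pa i} ⊕ {x // x ∈ J}),
    f = ((G.nestedMatrix i J).submatrix e id).det}

end Models

end MixedGraph

/-- The entries of a symmetric matrix, as values for the indeterminates `σ_{ij} = σ_{ji}`. -/
def symEntries {V : Type*} (S : Matrix V V ℝ) (hS : S.IsSymm) : Sym2 V → ℝ :=
  Sym2.lift ⟨fun i j => S i j, fun i j => hS.apply j i⟩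

/-- The symmetric matrices at which all polynomials in `F` vanish. -/
def symZeroLocus {V : Type*} (F : Set (MvPolynomial (Sym2 V) ℝ)) : Set (Matrix V V ℝ) :=
  {S | ∃ hS : S.IsSymm, ∀ f ∈ F, MvPolynomial.eval (symEntries S hS) f = 0}

/-- For a mixed graph on `Fin p`, all parentally nested determinants obtained from the pairs
`(i, {j | j < i} \ (pa(i) ∪ sib(i)))`. -/
def MixedGraph.ancestralConstraints {p : ℕ} (G : MixedGraph (Fin p)) :
    Set (MvPolynomial (Sym2 (Fin p)) ℝ) :=
  ⋃ i : Fin p, G.parentallyNestedDets i (Finset.Iio i \ (G.pa i ∪ G.sib i))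

/-!
For a positive definite `Σ` and coefficients `Λ` supported on the directed edges, let
`ε = (I - Λ)ᵀ X` be the errors of the structural equations, where `X` has covariance matrix `Σ`.
Then `Σ` lies in the model if and only if `Λ` can be chosen so that `ε_r` and `ε_i` are uncorrelated
for all `r < i` with `r ∉ sib(i)`. By global identifiability there are no bows, so these `r` are the
row labels `pa(i) ∪ J` of the matrix `F_{i,J}` with `J = [i - 1] \ (pa(i) ∪ sib(i))`.

All these `r` are ancestral. An ancestral `r` has no siblings among its ancestors, so `ε_r` is
uncorrelated with its parents (`IsAncestral.crossCov_eq_zero`), and a Schur complement shows that row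
`r` of `F_{i,J}` is a positive multiple of the covariances of `ε_r` with the `X_c`, for
`c ∈ pa(i) ∪ {i}` (`eval_parentDet`). Being uncorrelated with all these `ε_r` thus means that the
coefficients `(-λ_i, 1)` of `ε_i` form a kernel vector of `F_{i,J}`; this gives the inclusion
`model_subset`.

Conversely, let the minors vanish, and determine the columns of `Λ` one after the other
(`subset_model`). At vertex `i` there is a nonzero kernel vector of `F_{i,J}`, and the task is to see
that its last entry is nonzero (`exists_update`). Otherwise there is a nonzero combination
`∑ u_a X_a = ∑ v_b ε_b` of the parents of `i`, with `v = (I - Λ)⁻¹ u`, that is uncorrelated with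
`ε_r` for all `r < i` that are not siblings of `i`. Let `A` consist of `i` and the support of `v`.
Every `r ∈ A` other than `i` has a child in `A`, so `i` is the only sink. The part `y` of `v` outside
the bidirected component of `i` in `A` satisfies `yᵀ Ω y = 0` with `Ω` the covariance matrix of `ε`,
so it is zero and `A` is connected by bidirected edges. This contradicts global
identifiability (`GloballyIdentifiable.eq_zero_of_errorCov`).
-/

open Matrix

/-! ### Maximal minors -/

/-- If all maximal minors of `M` on its full set of columns vanish, the columns of `M` are linearly
dependent. -/
theorem Matrix.exists_mulVec_eq_zero_of_minors {m n K : Type*} [Field K] [Fintype m] [Fintype n]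
    [DecidableEq n] (M : Matrix m n K) (h : ∀ e : n ↪ m, (M.submatrix e id).det = 0) :
    ∃ w ≠ 0, M *ᵥ w = 0 := by
  by_contra! hM
  obtain ⟨κ, a, ha, hspan, hli⟩ := exists_linearIndependent' K M.row
  have : Fintype κ := Fintype.ofInjective a ha
  have hcol : LinearIndependent K Mᵀ.row := by
    rw [row_transpose, ← mulVec_injective_iff]
    refine (injective_iff_map_eq_zero M.mulVecLin).2 fun w hw => ?_
    by_contra hw0
    exact hM w hw0 hw
  have hcard : Fintype.card n = Fintype.card κ := by
    rw [← finrank_span_eq_card hli, hspan, ← rank_eq_finrank_span_row, ← rank_transpose,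
      hcol.rank_matrix]
  obtain ⟨f⟩ := Fintype.card_eq.1 hcard
  have hli' : LinearIndependent K (M.submatrix (a ∘ f) id).row := hli.comp f f.injective
  rw [linearIndependent_rows_iff_isUnit, isUnit_iff_isUnit_det] at hli'
  exact hli'.ne_zero (h ⟨a ∘ f, ha.comp f.injective⟩)

namespace MixedGraph

/-! ### Error covariances and parent determinants -/

section General

theorem mem_pa {V : Type*} [Fintype V] (G : MixedGraph V) {i j : V} :
    j ∈ G.pa i ↔ (j, i) ∈ G.dir := by
  simp [pa]

theorem mem_sib {V : Type*} [Fintype V] (G : MixedGraph V) {i j : V} :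
    j ∈ G.sib i ↔ s(j, i) ∈ G.bidir := by
  simp [sib]

theorem isSymm_of_posDef {V : Type*} {S : Matrix V V ℝ} (hS : S.PosDef) : S.IsSymm := by
  have := hS.isHermitian
  rwa [IsHermitian, conjTranspose_eq_transpose_of_trivial] at this

variable {V : Type*} [Fintype V] [DecidableEq V] (G : MixedGraph V)

/-- The covariance matrix of the errors `ε = (I - Λ)ᵀ X` of the structural equations with
coefficients `L`, where `S` is the covariance matrix of `X`. -/
def errorCov (S L : Matrix V V ℝ) : Matrix V V ℝ := (1 - L)ᵀ * S * (1 - L)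

/-- The matrix of covariances between the errors `ε = (I - Λ)ᵀ X` (rows) and the variables `X`
(columns). -/
def crossCov (S L : Matrix V V ℝ) : Matrix V V ℝ := (1 - L)ᵀ * S

theorem crossCov_apply (S L : Matrix V V ℝ) (r c : V) :
    crossCov S L r c = S r c - ∑ a, L a r * S a c := by
  rw [crossCov, transpose_sub, transpose_one, Matrix.sub_mul, Matrix.one_mul, Matrix.sub_apply,
    Matrix.mul_apply]
  rfl

theorem errorCov_apply (S L : Matrix V V ℝ) (r j : V) :
    errorCov S L r j = crossCov S L r j - ∑ a, crossCov S L r a * L a j := by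
  rw [errorCov, ← crossCov, Matrix.mul_sub, Matrix.mul_one, Matrix.sub_apply, Matrix.mul_apply]

theorem errorCov_comm {S : Matrix V V ℝ} (hS : S.IsSymm) (L : Matrix V V ℝ) (r j : V) :
    errorCov S L r j = errorCov S L j r := by
  have : (errorCov S L)ᵀ = errorCov S L := by
    simp [errorCov, transpose_mul, hS.eq, Matrix.mul_assoc]
  conv_rhs => rw [← this]
  rfl

theorem crossCov_congr (S : Matrix V V ℝ) {L L' : Matrix V V ℝ} {r : V}
    (hr : ∀ a, L a r = L' a r) (c : V) : crossCov S L r c = crossCov S L' r c := by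
  simp [crossCov_apply, hr]

theorem errorCov_congr (S : Matrix V V ℝ) {L L' : Matrix V V ℝ} {r j : V}
    (hr : ∀ a, L a r = L' a r) (hj : ∀ a, L a j = L' a j) :
    errorCov S L r j = errorCov S L' r j := by
  simp [errorCov_apply, crossCov_congr S hr, hj]

theorem posDef_congr {S A : Matrix V V ℝ} (hS : S.PosDef) (hA : IsUnit A) :
    (Aᵀ * S * A).PosDef := by
  have := hS.conjTranspose_mul_mul_same (B := A) (mulVec_injective_iff_isUnit.2 hA)
  rwa [conjTranspose_eq_transpose_of_trivial] at this

/-- If `ε_r` is uncorrelated with the parents of `r`, it is the residual of the regression of `X_r`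
on them, and `|Σ_{pa(r) ⊎ {r}, pa(r) ⊎ {c}}|` is, by the Schur complement, `|Σ_{pa(r), pa(r)}|` times
the covariance of `ε_r` and `X_c`. -/
theorem eval_parentDet {S L : Matrix V V ℝ} (hS : S.PosDef) (hsymm : S.IsSymm)
    (hL : ∀ i j, (i, j) ∉ G.dir → L i j = 0) {r : V}
    (hr : ∀ a ∈ G.pa r, crossCov S L r a = 0) (c : V) :
    MvPolynomial.eval (symEntries S hsymm) (G.parentDet r c) =
      (S.submatrix (fun a : {x // x ∈ G.pa r} => (a : V))
        (fun a : {x // x ∈ G.pa r} => (a : V))).det *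
        crossCov S L r c := by
  set A := S.submatrix (fun a : {x // x ∈ G.pa r} => (a : V))
    (fun a : {x // x ∈ G.pa r} => (a : V))
  have hsum : ∀ b, crossCov S L r b = S r b - ∑ a : {x // x ∈ G.pa r}, L a r * S a b := by
    intro b
    rw [crossCov_apply, Finset.sum_coe_sort (G.pa r) fun a => L a r * S a b]
    congr 1
    refine (Finset.sum_subset (Finset.subset_univ _) fun a _ ha => ?_).symm
    rw [hL a r (fun h => ha (G.mem_pa.2 h)), zero_mul]
  let B : Matrix {x // x ∈ G.pa r} Unit ℝ := of fun a _ => S a c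
  let C : Matrix Unit {x // x ∈ G.pa r} ℝ := of fun _ a => S r a
  let D : Matrix Unit Unit ℝ := of fun _ _ => S r c
  let R : Matrix Unit {x // x ∈ G.pa r} ℝ := of fun _ a => L a r
  have hAinv : IsUnit A := (hS.submatrix Subtype.val_injective).isUnit
  let : Invertible A := hAinv.invertible
  have hC : C = R * A := by
    ext _ b
    have := hr b b.2
    rw [hsum, sub_eq_zero] at this
    simpa [C, R, A, Matrix.mul_apply] using this
  have hmat : ((symbolicCov (V := V)).submatrix
      (Sum.elim (fun a : {x // x ∈ G.pa r} => (a : V)) (fun _ : Unit => r))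
      (Sum.elim (fun a : {x // x ∈ G.pa r} => (a : V)) (fun _ : Unit => c))).map
      (MvPolynomial.eval (symEntries S hsymm)) = fromBlocks A B C D := by
    ext (x | x) (y | y) <;> simp [symbolicCov, symEntries, A, B, C, D]
  rw [parentDet, RingHom.map_det, RingHom.mapMatrix_apply, hmat, det_fromBlocks₁₁, hC,
    Matrix.mul_assoc R, mul_invOf_self, Matrix.mul_one, det_unique (n := Unit), hsum]
  simp [D, R, B, Matrix.mul_apply]

end General

/-! ### Topologically ordered graphs -/

section Ordered

variable {p : ℕ} (G : MixedGraph (Fin p))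

/-- In a topological order `I - Λ` is unitriangular. -/
theorem isUnit_one_sub {L : Matrix (Fin p) (Fin p) ℝ}
    (hTop : ∀ i j : Fin p, (i, j) ∈ G.dir → i < j) (hL : ∀ i j, (i, j) ∉ G.dir → L i j = 0) :
    IsUnit (1 - L) := by
  have h0 : ∀ i j, j ≤ i → L i j = 0 := fun i j hji =>
    hL i j fun h => (hTop i j h).not_ge hji
  have ht : (1 - L).BlockTriangular id := by
    intro i j hij
    simp [h0 i j (le_of_lt hij), one_apply_ne (ne_of_gt hij : i ≠ j)]
  rw [isUnit_iff_isUnit_det, det_of_isUpperTriangular ht]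
  simp [h0]

theorem lt_of_hasDirectedPath (hTop : ∀ i j : Fin p, (i, j) ∈ G.dir → i < j) {i j : Fin p}
    (h : G.HasDirectedPath i j) : i < j := by
  induction h with
  | single h => exact hTop _ _ h
  | tail _ h ih => exact ih.trans (hTop _ _ h)

/-- An error `ε_r` uncorrelated with the errors of all ancestors of `r` is uncorrelated with the
ancestors of `r` themselves, as these are combinations of those errors. -/
theorem crossCov_eq_zero_of_ancestor {S L : Matrix (Fin p) (Fin p) ℝ}
    (hTop : ∀ i j : Fin p, (i, j) ∈ G.dir → i < j) (hL : ∀ i j, (i, j) ∉ G.dir → L i j = 0)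
    {r : Fin p} (h : ∀ b, G.HasDirectedPath b r → errorCov S L r b = 0) (a : Fin p)
    (ha : G.HasDirectedPath a r) : crossCov S L r a = 0 := by
  induction a using WellFoundedLT.induction with
  | ind a ih =>
    have := h a ha
    rw [errorCov_apply, Finset.sum_eq_zero, sub_zero] at this
    · exact this
    intro b _
    by_cases hb : (b, a) ∈ G.dir
    · rw [ih b (hTop b a hb) (.head hb ha), zero_mul]
    · rw [hL b a hb, mul_zero]

/-- The error of an ancestral vertex is uncorrelated with the parents of that vertex. -/
theorem IsAncestral.crossCov_eq_zero {S L : Matrix (Fin p) (Fin p) ℝ} (hS : S.IsSymm)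
    (hTop : ∀ i j : Fin p, (i, j) ∈ G.dir → i < j) (hL : ∀ i j, (i, j) ∉ G.dir → L i j = 0)
    {r : Fin p} (hr : G.IsAncestral r) (h : ∀ b < r, b ∉ G.sib r → errorCov S L b r = 0)
    (a : Fin p) (ha : a ∈ G.pa r) : crossCov S L r a = 0 := by
  refine G.crossCov_eq_zero_of_ancestor hTop hL (fun b hb => ?_) a (.single (G.mem_pa.1 ha))
  have hlt := G.lt_of_hasDirectedPath hTop hb
  rw [errorCov_comm hS]
  exact h b hlt fun hs => hr.2 b hlt.ne ⟨G.mem_sib.1 hs, hb⟩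

/-! ### Consequences of global identifiability -/

/-- A globally identifiable graph has no bow `a → b`, `a ↔ b`, as this would be a subgraph with
connected bidirected part and unique sink `b`. -/
theorem GloballyIdentifiable.not_mem_sib (hG : G.GloballyIdentifiable)
    (hTop : ∀ i j : Fin p, (i, j) ∈ G.dir → i < j) {a b : Fin p} (ha : a ∈ G.pa b) :
    a ∉ G.sib b := by
  rw [mem_pa] at ha
  rw [mem_sib]
  intro hs
  have hab := (hTop a b ha).ne
  let A : Set (Fin p) := {a, b}
  let H : MixedGraph A :=
    ⟨{e | ((e.1 : Fin p), (e.2 : Fin p)) ∈ G.dir}, {e | e.map (↑) ∈ G.bidir}⟩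
  let a' : A := ⟨a, .inl rfl⟩
  let b' : A := ⟨b, .inr rfl⟩
  have hadj : (SimpleGraph.fromEdgeSet H.bidir).Adj a' b' :=
    (SimpleGraph.fromEdgeSet_adj _).2 ⟨hs, fun h => hab (congrArg Subtype.val h)⟩
  have hreach : ∀ y : A, (SimpleGraph.fromEdgeSet H.bidir).Reachable b' y := by
    rintro ⟨y, rfl | rfl⟩
    · exact hadj.reachable.symm
    · exact .rfl
  have : Nonempty A := ⟨b'⟩
  refine hG.2 A H ⟨a, .inl rfl, b, .inr rfl, hab⟩ ⟨fun e he => he, fun e he => he⟩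
    ⟨⟨fun x y => (hreach x).symm.trans (hreach y)⟩, b', ?_, ?_⟩
  · rintro ⟨w, rfl | rfl⟩ hw h
    · exact (hTop _ _ h).not_gt (hTop _ _ ha)
    · exact hw rfl
  · rintro ⟨w, rfl | rfl⟩ hsink
    · exact absurd ha (hsink b' fun h => hab (congrArg Subtype.val h).symm)
    · rfl

/-- Here `v = (I - Λ)⁻¹ u` for a vector `u` supported on `pa(i)`, so that `∑ v_b ε_b = ∑ u_a X_a`. If
this combination of the parents of `i` is uncorrelated with the errors of all non-siblings before
`i`, it is zero: otherwise the subgraph induced on `i` and the support of `v` would be connected by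
bidirected edges and have `i` as its unique sink. -/
theorem GloballyIdentifiable.eq_zero_of_errorCov (hG : G.GloballyIdentifiable)
    (hTop : ∀ i j : Fin p, (i, j) ∈ G.dir → i < j)
    {L W : Matrix (Fin p) (Fin p) ℝ} (hL : ∀ i j, (i, j) ∉ G.dir → L i j = 0) (hW : W.PosDef)
    {i : Fin p} (hWi : ∀ a < i, ∀ b < i, a ≠ b → s(a, b) ∉ G.bidir → W a b = 0)
    {v : Fin p → ℝ} (hv : ∀ r ∉ G.pa i, v r = (L *ᵥ v) r)
    (hWv : ∀ r < i, r ∉ G.sib i → (W *ᵥ v) r = 0) : v = 0 := by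
  have hchild : ∀ r, v r ≠ 0 → (r, i) ∈ G.dir ∨ ∃ s, (r, s) ∈ G.dir ∧ v s ≠ 0 := by
    intro r hr
    by_cases hri : r ∈ G.pa i
    · exact .inl (G.mem_pa.1 hri)
    have hr' : ∑ s, L r s * v s ≠ 0 := by rwa [hv r hri] at hr
    obtain ⟨s, -, hs⟩ := Finset.exists_ne_zero_of_sum_ne_zero hr'
    exact .inr ⟨s, by_contra fun h => hs (by simp [hL r s h]), right_ne_zero_of_mul hs⟩
  have hlt : ∀ r, v r ≠ 0 → r < i := by
    intro r
    induction r using WellFoundedGT.induction with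
    | ind r ih =>
      intro hr
      obtain h | ⟨s, hrs, hs⟩ := hchild r hr
      · exact hTop r i h
      · exact (hTop r s hrs).trans (ih s (hTop r s hrs) hs)
  by_contra hv0
  obtain ⟨x, hx⟩ := Function.ne_iff.1 hv0
  let A : Set (Fin p) := {r | r = i ∨ v r ≠ 0}
  let H : MixedGraph A :=
    ⟨{e | ((e.1 : Fin p), (e.2 : Fin p)) ∈ G.dir}, {e | e.map (↑) ∈ G.bidir}⟩
  let i' : A := ⟨i, .inl rfl⟩
  refine hG.2 A H ⟨i, .inl rfl, x, .inr hx, (hlt x hx).ne'⟩ ⟨fun e he => he, fun e he => he⟩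
    ⟨?_, i', ?_, ?_⟩
  · have hreach : ∀ y : A, (SimpleGraph.fromEdgeSet H.bidir).Reachable i' y := by
      classical
      -- `y` is the part of `v` outside the bidirected component of `i`; it is `W`-orthogonal to
      -- the rest of `v`, so that `yᵀ W y = yᵀ W v = 0`.
      let R : Fin p → Prop := fun a =>
        ∃ h : a ∈ A, (SimpleGraph.fromEdgeSet H.bidir).Reachable i' ⟨a, h⟩
      let y : Fin p → ℝ := fun a => if R a then 0 else v a
      have hstep : ∀ a b, R a → b ∈ A → a ≠ b → ¬ R b → s(b, a) ∉ G.bidir := by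
        rintro a b ⟨ha, hra⟩ hb hab hRb hs
        refine hRb ⟨hb, hra.trans (SimpleGraph.Adj.reachable ?_)⟩
        rw [SimpleGraph.fromEdgeSet_adj]
        refine ⟨?_, fun h => hab (congrArg Subtype.val h)⟩
        change s(a, b) ∈ G.bidir
        rwa [Sym2.eq_swap]
      have hy : ∀ a, y a ≠ 0 → ¬ R a ∧ v a ≠ 0 := fun a ha => by
        by_cases hR : R a <;> simp_all [y]
      have hRi : R i := ⟨.inl rfl, .rfl⟩
      have hWy : ∀ a, y a ≠ 0 → (W *ᵥ y) a = 0 := by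
        intro a ha
        obtain ⟨hRa, hva⟩ := hy a ha
        rw [← hWv a (hlt a hva) fun hs =>
          hstep i a hRi (.inr hva) (hlt a hva).ne' hRa (G.mem_sib.1 hs)]
        change ∑ b, W a b * y b = ∑ b, W a b * v b
        refine Finset.sum_congr rfl fun b _ => ?_
        by_cases hRb : R b
        · by_cases hvb : v b = 0
          · simp [y, hvb]
          have hab : a ≠ b := fun h => hRa (h ▸ hRb)
          simp [hWi a (hlt a hva) b (hlt b hvb) hab (hstep b a hRb (.inr hva) hab.symm hRa)]
        · simp [y, hRb]
      have hy0 : y = 0 := by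
        by_contra hne
        have := hW.dotProduct_mulVec_pos hne
        rw [dotProduct, Finset.sum_eq_zero] at this
        · exact this.false
        intro a _
        by_cases ha : y a = 0
        · simp [ha]
        · rw [hWy a ha, mul_zero]
      rintro ⟨a, ha⟩
      by_contra hRa
      have hRa' : ¬ R a := fun ⟨_, h⟩ => hRa h
      have hva : v a = 0 := by simpa [y, hRa'] using congrFun hy0 a
      rcases ha with rfl | ha
      · exact hRa' hRi
      · exact ha hva
    have : Nonempty A := ⟨i'⟩
    exact ⟨fun a b => (hreach a).symm.trans (hreach b)⟩
  · rintro ⟨w, hw⟩ hwi h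
    rcases hw with rfl | hw
    · exact hwi rfl
    · exact (hTop _ _ h).not_gt (hlt w hw)
  · rintro ⟨w, hw⟩ hsink
    rcases hw with rfl | hw
    · rfl
    exfalso
    obtain h | ⟨s, hws, hs⟩ := hchild w hw
    · exact hsink i' (fun h => (hlt w hw).ne (congrArg Subtype.val h).symm) h
    · exact hsink ⟨s, .inr hs⟩ (fun h => (hTop w s hws).ne (congrArg Subtype.val h).symm) hws

/-! ### The kernel of the nested matrix -/

/-- For `r ∈ [i - 1]`, the determinant `|Σ_{pa(r) ⊎ {r}, pa(r) ⊎ {c}}|` is a positive multiple of the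
covariance of `ε_r` and `X_c`, as soon as the errors of the vertices in `[i - 1]` that are not
siblings are uncorrelated. -/
theorem exists_pos_eval_parentDet {S L : Matrix (Fin p) (Fin p) ℝ} (hS : S.PosDef)
    (hsymm : S.IsSymm) (hTop : ∀ i j : Fin p, (i, j) ∈ G.dir → i < j)
    (hAnc : ∀ v : Fin p, (v : ℕ) + 1 < p → G.IsAncestral v)
    (hL : ∀ i j, (i, j) ∉ G.dir → L i j = 0) {i : Fin p}
    (h : ∀ r < i, ∀ b < r, b ∉ G.sib r → errorCov S L b r = 0) {r : Fin p} (hr : r < i) :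
    ∃ d : ℝ, 0 < d ∧ ∀ c, MvPolynomial.eval (symEntries S hsymm) (G.parentDet r c) =
      d * crossCov S L r c :=
  ⟨_, (hS.submatrix Subtype.val_injective).det_pos, G.eval_parentDet hS hsymm hL
    ((hAnc r (by omega)).crossCov_eq_zero G hsymm hTop hL (h r hr))⟩

/-- Under the hypotheses of `exists_pos_eval_parentDet`, the kernel of the matrix `F_{i,J}` evaluated
at `S` consists of the linear combinations of the `X_c` with `c ∈ pa(i) ⊎ {i}` that are uncorrelated
with `ε_r` for all `r ∈ pa(i) ∪ J`. -/
theorem eval_nestedMatrix_mulVec_eq_zero_iff {S L : Matrix (Fin p) (Fin p) ℝ} (hS : S.PosDef)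
    (hsymm : S.IsSymm) (hTop : ∀ i j : Fin p, (i, j) ∈ G.dir → i < j)
    (hAnc : ∀ v : Fin p, (v : ℕ) + 1 < p → G.IsAncestral v)
    (hL : ∀ i j, (i, j) ∉ G.dir → L i j = 0) {i : Fin p}
    (h : ∀ r < i, ∀ b < r, b ∉ G.sib r → errorCov S L b r = 0) {J : Finset (Fin p)}
    (hJ : ∀ r ∈ J, r < i) (w : {x // x ∈ G.pa i} ⊕ Unit → ℝ) :
    (G.nestedMatrix i J).map (MvPolynomial.eval (symEntries S hsymm)) *ᵥ w = 0 ↔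
      ∀ r ∈ G.pa i ∪ J,
        ∑ a : {x // x ∈ G.pa i}, crossCov S L r a * w (.inl a) +
          crossCov S L r i * w (.inr ()) = 0 := by
  have key : ∀ r < i, (∑ c : {x // x ∈ G.pa i} ⊕ Unit,
      MvPolynomial.eval (symEntries S hsymm) (G.parentDet r
        (Sum.elim (fun a : {x // x ∈ G.pa i} => (a : Fin p)) (fun _ : Unit => i) c)) * w c = 0 ↔
      ∑ a : {x // x ∈ G.pa i}, crossCov S L r a * w (.inl a) +
          crossCov S L r i * w (.inr ()) = 0) := by
    intro r hr
    obtain ⟨d, hd, hdet⟩ := G.exists_pos_eval_parentDet hS hsymm hTop hAnc hL h hr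
    simp only [hdet, mul_assoc, ← Finset.mul_sum, mul_eq_zero, hd.ne', false_or]
    simp
  have hpa : ∀ r ∈ G.pa i, r < i := fun r hr => hTop r i (G.mem_pa.1 hr)
  rw [funext_iff]
  constructor
  · intro hw r hr
    rcases Finset.mem_union.1 hr with hr | hr
    · exact (key r (hpa r hr)).1 (hw (.inl ⟨r, hr⟩))
    · exact (key r (hJ r hr)).1 (hw (.inr ⟨r, hr⟩))
  · rintro hw (⟨r, hr⟩ | ⟨r, hr⟩)
    · exact (key r (hpa r hr)).2 (hw r (Finset.mem_union_left _ hr))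
    · exact (key r (hJ r hr)).2 (hw r (Finset.mem_union_right _ hr))

/-- The row labels `pa(i) ∪ J` of `F_{i,J}` for `J = [i - 1] \ (pa(i) ∪ sib(i))` are all the
non-siblings before `i`; parents of `i` are not siblings because there are no bows. -/
theorem GloballyIdentifiable.mem_union_iff (hG : G.GloballyIdentifiable)
    (hTop : ∀ i j : Fin p, (i, j) ∈ G.dir → i < j) {i r : Fin p} :
    r ∈ G.pa i ∪ (Finset.Iio i \ (G.pa i ∪ G.sib i)) ↔ r < i ∧ r ∉ G.sib i := by
  have h1 : r ∈ G.pa i → r ∉ G.sib i := hG.not_mem_sib G hTop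
  have h2 : r ∈ G.pa i → r < i := fun h => hTop r i (G.mem_pa.1 h)
  simp only [Finset.mem_union, Finset.mem_sdiff, Finset.mem_Iio]
  tauto

theorem eval_det_submatrix {S : Matrix (Fin p) (Fin p) ℝ} (hsymm : S.IsSymm) (i : Fin p)
    (J : Finset (Fin p))
    (e : ({x // x ∈ G.pa i} ⊕ Unit) ↪ ({x // x ∈ G.pa i} ⊕ {x // x ∈ J})) :
    MvPolynomial.eval (symEntries S hsymm) ((G.nestedMatrix i J).submatrix e id).det =
      (((G.nestedMatrix i J).map (MvPolynomial.eval (symEntries S hsymm))).submatrix e id).det := by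
  rw [RingHom.map_det]
  rfl

/-! ### The two inclusions -/

theorem model_subset (hG : G.GloballyIdentifiable)
    (hTop : ∀ i j : Fin p, (i, j) ∈ G.dir → i < j)
    (hAnc : ∀ v : Fin p, (v : ℕ) + 1 < p → G.IsAncestral v) :
    G.model ⊆ {S : Matrix (Fin p) (Fin p) ℝ | S.PosDef} ∩ symZeroLocus G.ancestralConstraints := by
  rintro S ⟨L, ⟨hL, hunit⟩, W, ⟨hW, hWB⟩, rfl⟩
  set S := ((1 - L)⁻¹)ᵀ * W * (1 - L)⁻¹ with hSdef
  have hinv := (isUnit_iff_isUnit_det _).1 hunit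
  have hS : S.PosDef := posDef_congr hW (isUnit_nonsing_inv_iff.2 hunit)
  have hsymm := isSymm_of_posDef hS
  have hcov : errorCov S L = W := by
    rw [errorCov, hSdef]
    simp only [Matrix.mul_assoc, nonsing_inv_mul _ hinv, Matrix.mul_one]
    rw [← Matrix.mul_assoc, ← transpose_mul, nonsing_inv_mul _ hinv, transpose_one,
      Matrix.one_mul]
  have hzero : ∀ r j, r < j → r ∉ G.sib j → errorCov S L r j = 0 := fun r j hrj hr => by
    rw [hcov]
    exact hWB r j hrj.ne fun h => hr (G.mem_sib.2 h)
  refine ⟨hS, hsymm, fun f hf => ?_⟩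
  obtain ⟨i, e, rfl⟩ := Set.mem_iUnion.1 hf
  rw [eval_det_submatrix]
  -- The coefficients of `ε_i` form a kernel vector.
  let w : {x // x ∈ G.pa i} ⊕ Unit → ℝ := Sum.elim (fun a => -L a i) (fun _ => 1)
  refine exists_mulVec_eq_zero_iff.1 ⟨w, fun h => one_ne_zero (congrFun h (.inr ())), ?_⟩
  have hw := (G.eval_nestedMatrix_mulVec_eq_zero_iff hS hsymm hTop hAnc hL
    (fun r _ b hb => hzero b r hb) (J := Finset.Iio i \ (G.pa i ∪ G.sib i)) (by simp +contextual)
    w).2 ?_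
  · ext x
    exact congrFun hw (e x)
  · intro r hr
    rw [hG.mem_union_iff G hTop] at hr
    have := hzero r i hr.1 hr.2
    rw [errorCov_apply, ← Finset.sum_subset (Finset.subset_univ (G.pa i)) fun a _ ha => by
      rw [hL a i (fun h => ha (G.mem_pa.2 h)), mul_zero], ← Finset.sum_coe_sort] at this
    simp only [w, Sum.elim_inl, Sum.elim_inr, mul_neg, Finset.sum_neg_distrib, mul_one]
    linarith

/-- The recursive step solving for the coefficients at vertex `i`: the minors give a linear relation
between the columns of `F_{i,J}`, and global identifiability forces the last coefficient of
this relation to be nonzero. -/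
theorem exists_update (hG : G.GloballyIdentifiable)
    (hTop : ∀ i j : Fin p, (i, j) ∈ G.dir → i < j)
    (hAnc : ∀ v : Fin p, (v : ℕ) + 1 < p → G.IsAncestral v)
    {S : Matrix (Fin p) (Fin p) ℝ} (hS : S.PosDef) (hmem : S ∈ symZeroLocus G.ancestralConstraints)
    {L : Matrix (Fin p) (Fin p) ℝ} (hL : ∀ i j, (i, j) ∉ G.dir → L i j = 0) (i : Fin p)
    (h : ∀ r < i, ∀ b < r, b ∉ G.sib r → errorCov S L b r = 0) :
    ∃ l : Fin p → ℝ, (∀ a, (a, i) ∉ G.dir → l a = 0) ∧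
      ∀ r < i, r ∉ G.sib i → crossCov S L r i - ∑ a, crossCov S L r a * l a = 0 := by
  obtain ⟨hsymm, hmem⟩ := hmem
  set J := Finset.Iio i \ (G.pa i ∪ G.sib i)
  obtain ⟨w, hw0, hw⟩ := exists_mulVec_eq_zero_of_minors
    ((G.nestedMatrix i J).map (MvPolynomial.eval (symEntries S hsymm))) fun e => by
      rw [← eval_det_submatrix]
      exact hmem _ (Set.mem_iUnion.2 ⟨i, e, rfl⟩)
  rw [G.eval_nestedMatrix_mulVec_eq_zero_iff hS hsymm hTop hAnc hL h (by simp +contextual [J])]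
    at hw
  -- `u` is the part of `w` indexed by `pa(i)`, extended by zero.
  let u : Fin p → ℝ := fun a => if ha : a ∈ G.pa i then w (.inl ⟨a, ha⟩) else 0
  have hu0 : ∀ a ∉ G.pa i, u a = 0 := fun a ha => dif_neg ha
  have hu : ∀ r, ∑ a : {x // x ∈ G.pa i}, crossCov S L r a * w (.inl a) =
      ∑ a, crossCov S L r a * u a := by
    intro r
    rw [← Finset.sum_subset (Finset.subset_univ (G.pa i)) fun a _ ha => by
      rw [hu0 a ha, mul_zero], ← Finset.sum_coe_sort (G.pa i)]
    exact Finset.sum_congr rfl fun a _ => by simp [u]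
  have hw' : ∀ r < i, r ∉ G.sib i →
      ∑ a, crossCov S L r a * u a + crossCov S L r i * w (.inr ()) = 0 := by
    intro r hr hrs
    rw [← hu]
    exact hw r ((hG.mem_union_iff G hTop).2 ⟨hr, hrs⟩)
  have ht : w (.inr ()) ≠ 0 := by
    intro ht
    have hunit := G.isUnit_one_sub hTop hL
    let v := (1 - L)⁻¹ *ᵥ u
    have hvu : (1 - L) *ᵥ v = u := by
      rw [mulVec_mulVec, mul_nonsing_inv _ ((isUnit_iff_isUnit_det _).1 hunit), one_mulVec]
    have hv : v = 0 := by
      refine hG.eq_zero_of_errorCov G hTop hL (posDef_congr hS hunit) (i := i) ?_ ?_ ?_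
      · intro a ha b hb hab hs
        change errorCov S L a b = 0
        rcases hab.lt_or_gt with hab | hab
        · exact h b hb a hab fun hm => hs (G.mem_sib.1 hm)
        · rw [errorCov_comm hsymm]
          exact h a ha b hab fun hm => hs (Sym2.eq_swap ▸ G.mem_sib.1 hm)
      · intro r hr
        have := congrFun hvu r
        rw [hu0 r hr, sub_mulVec, one_mulVec, Pi.sub_apply] at this
        exact sub_eq_zero.1 this
      · intro r hr hrs
        rw [← mulVec_mulVec, hvu]
        have := hw' r hr hrs
        rwa [ht, mul_zero, add_zero] at this
    have hu' : u = 0 := by rw [← hvu, hv, mulVec_zero]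
    apply hw0
    ext (a | _)
    · simpa [u] using congrFun hu' a
    · exact ht
  refine ⟨fun a => -(u a / w (.inr ())), fun a ha => ?_, fun r hr hrs => ?_⟩
  · change -(u a / w (.inr ())) = 0
    rw [hu0 a fun h => ha (G.mem_pa.1 h), zero_div, neg_zero]
  · have := hw' r hr hrs
    simp only [mul_neg, Finset.sum_neg_distrib, ← mul_div_assoc, ← Finset.sum_div]
    field_simp
    linarith

theorem subset_model (hG : G.GloballyIdentifiable)
    (hTop : ∀ i j : Fin p, (i, j) ∈ G.dir → i < j)
    (hAnc : ∀ v : Fin p, (v : ℕ) + 1 < p → G.IsAncestral v) :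
    {S : Matrix (Fin p) (Fin p) ℝ | S.PosDef} ∩ symZeroLocus G.ancestralConstraints ⊆ G.model := by
  rintro S ⟨hS, hmem⟩
  have hsymm := isSymm_of_posDef hS
  -- The first `n` columns can be chosen so that all constraints between the first `n` errors hold.
  have hrec : ∀ n : ℕ, ∃ L : Matrix (Fin p) (Fin p) ℝ, (∀ i j, (i, j) ∉ G.dir → L i j = 0) ∧
      ∀ j : Fin p, (j : ℕ) < n → ∀ r < j, r ∉ G.sib j → errorCov S L r j = 0 := by
    intro n
    induction n with
    | zero => exact ⟨0, fun _ _ _ => rfl, fun j hj => absurd hj (Nat.not_lt_zero _)⟩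
    | succ n ih =>
      obtain ⟨L, hL, hcov⟩ := ih
      by_cases hn : p ≤ n
      · exact ⟨L, hL, fun j _ => hcov j (j.2.trans_le hn)⟩
      let i : Fin p := ⟨n, not_le.1 hn⟩
      obtain ⟨l, hl, hli⟩ := G.exists_update hG hTop hAnc hS hmem hL i fun r hr => hcov r hr
      have hne : ∀ a j, j < i → L.updateCol i l a j = L a j := fun a j hj =>
        updateCol_ne hj.ne
      refine ⟨L.updateCol i l, fun a j haj => ?_, fun j hj r hrj hr => ?_⟩
      · by_cases hji : j = i
        · subst hji
          rw [updateCol_self]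
          exact hl a haj
        · rw [updateCol_ne hji]
          exact hL a j haj
      · rcases (Nat.lt_succ_iff.1 hj).lt_or_eq with hjn | hjn
        · rw [errorCov_congr S (fun a => hne a r (hrj.trans hjn)) (fun a => hne a j hjn)]
          exact hcov j hjn r hrj hr
        · obtain rfl : j = i := Fin.ext hjn
          rw [errorCov_apply]
          simp only [crossCov_congr S (fun a => hne a r hrj), updateCol_self]
          exact hli r hrj hr
  obtain ⟨L, hL, hcov⟩ := hrec p
  have hunit := G.isUnit_one_sub hTop hL
  have hinv := (isUnit_iff_isUnit_det _).1 hunit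
  refine ⟨L, ⟨hL, hunit⟩, errorCov S L, ⟨posDef_congr hS hunit, fun r j hrj hs => ?_⟩, ?_⟩
  · rcases hrj.lt_or_gt with hlt | hlt
    · exact hcov j j.2 r hlt fun hm => hs (G.mem_sib.1 hm)
    · rw [errorCov_comm hsymm]
      exact hcov r r.2 j hlt fun hm => hs (Sym2.eq_swap ▸ G.mem_sib.1 hm)
  · rw [errorCov]
    simp only [Matrix.mul_assoc, mul_nonsing_inv _ hinv, Matrix.mul_one]
    rw [← Matrix.mul_assoc, ← transpose_mul, mul_nonsing_inv _ hinv, transpose_one,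
      Matrix.one_mul]

end Ordered

end MixedGraph

/-- The vertices `1, …, p` are the elements of `Fin p`; those of `[p - 1]` are the `v : Fin p` with
`(v : ℕ) + 1 < p`. -/
theorem theorem3p5 (p : ℕ) (G : MixedGraph (Fin p))
    (hG : G.GloballyIdentifiable)
    (hTop : ∀ i j : Fin p, (i, j) ∈ G.dir → i < j)
    (hAnc : ∀ v : Fin p, (v : ℕ) + 1 < p → G.IsAncestral v) :
    G.model =
      {S : Matrix (Fin p) (Fin p) ℝ | S.PosDef} ∩ symZeroLocus G.ancestralConstraints :=
  (G.model_subset hG hTop hAnc).antisymm (G.subset_model hG hTop hAnc)
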